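/- All graphs are simple with a non-empty vertex set. A graph $G$ is \emph{C-HH} if every homomorphism from a finite connected induced subgraph of $G$ into $G$ extends to an endomorphism of $G$ (a homomorphism is a map on vertices which sends edges to edges). A graph \emph{embeds} in $G$ if it is isomorphic to an induced subgraph of $G$; an \emph{induced cycle} of $G$ is an induced subgraph of $G$ that is a cycle of some length $k\ge 3$, and it is a \emph{square} if $k=4$. A vertex $v$ is a \emph{common neighbour} of a set $A$ of vertices if $v$ is adjacent to every element of $A$. For $n\ge 2$, a finite connected graph $G$ is \emph{$K_n$-treelike} if it is the union of a family of induced copies of $K_n$ (its \emph{components}) covering all vertices and edges of $G$, such that any two distinct components share at most one vertex and every induced cycle of $G$ is contained in a single component. The \emph{two-squares graph} is the graph on $v_1,\dots,v_6$ formed by the $6$-cycle $v_1v_2v_3v_4v_5v_6v_1$ together with the one long diagonal $v_3v_6$. For $n\ge 3$, $\overline{L(K_{2,n})}$, the \emph{bipartite complement of a perfect matching}, is the bipartite graph with parts $\{x_1,\dots,x_n\}$ and $\{y_1,\dots,y_n\}$ in which $x_i$ is adjacent to $y_j$ if and only if $i\ne j$. Theorem. Let $G$ be a finite connected graph. Then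 $G$ is C-HH if and only if it is (isomorphic to) at least one of the following: (i) $K_1$; (ii) a $K_n$-treelike graph for some $n\ge 2$; (iii) a graph all of whose induced cycles are squares (this holds vacuously if there are no cycles) and in which the two-squares graph does not embed; (iv) a bipartite graph such that each of its two parts has a common neighbour; (v) the bipartite complement of a perfect matching $\overline{L(K_{2,n})}$ for some $n\ge 3$. -/

import Mathlib

namespace CHomHom

/-- `G` is C-HH: every homomorphism from a finite connected induced subgraph of `G` into `G`
extends to an endomorphism of `G`. -/
def IsCHH {V : Type*} (G : SimpleGraph V) : Prop :=
  ∀ S : Set V, S.Finite → (G.induce S).Connected →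
    ∀ φ : G.induce S →g G, ∃ ψ : G →g G, ∀ x : S, ψ x = φ x

/-- `G` is `K_n`-treelike: it is a connected graph made of copies of `K_n` (the members of `𝒞`,
called components), which together account for all vertices and edges of `G`; two distinct
components are joined by identifying at most one pair of vertices, that is, they share at most one
vertex; and every induced cycle of `G` is contained in a single component. -/
def IsTreelike {V : Type*} (n : ℕ) (G : SimpleGraph V) : Prop :=
  G.Connected ∧ ∃ 𝒞 : Set (Finset V),
    (∀ C ∈ 𝒞, G.IsNClique n C) ∧
    (∀ v : V, ∃ C ∈ 𝒞, v ∈ C) ∧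
    (∀ u v : V, G.Adj u v → ∃ C ∈ 𝒞, u ∈ C ∧ v ∈ C) ∧
    (∀ C ∈ 𝒞, ∀ D ∈ 𝒞, C ≠ D → ∀ u v : V, u ∈ C → u ∈ D → v ∈ C → v ∈ D → u = v) ∧
    (∀ k : ℕ, 3 ≤ k → ∀ f : SimpleGraph.cycleGraph k ↪g G, ∃ C ∈ 𝒞, ∀ i : Fin k, f i ∈ C)

/-- Every induced cycle of `G` is a square (vacuously true when `G` has no cycles). -/
def AllInducedCyclesSquares {V : Type*} (G : SimpleGraph V) : Prop :=
  ∀ k : ℕ, 3 ≤ k → (SimpleGraph.cycleGraph k).IsIndContained G → k = 4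

/-- The two-squares graph: a 6-cycle together with one long diagonal. -/
def twoSquares : SimpleGraph (Fin 6) :=
  SimpleGraph.cycleGraph 6 ⊔ SimpleGraph.edge 2 5

/-- `G` is bipartite, with parts `X` and `Y`, such that each part has a common neighbour. -/
def IsBipartiteWithCommonNeighbours {V : Type*} (G : SimpleGraph V) : Prop :=
  ∃ X Y : Set V, G.IsBipartiteWith X Y ∧ X ∪ Y = Set.univ ∧
    (∃ v : V, ∀ x ∈ X, G.Adj v x) ∧ (∃ v : V, ∀ y ∈ Y, G.Adj v y)

/-- The bipartite complement of a perfect matching: the parts are `{x_i}` (`Sum.inl`) and `{y_j}`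
(`Sum.inr`), and `x_i` is adjacent to `y_j` if and only if `i ≠ j`. -/
def bipartiteComplementMatching (n : ℕ) : SimpleGraph (Fin n ⊕ Fin n) :=
  SimpleGraph.fromRel fun a b => ∃ i j : Fin n, i ≠ j ∧ a = Sum.inl i ∧ b = Sum.inr j

end CHomHom

namespace CHomHom

open SimpleGraph

variable {V : Type*} {G : SimpleGraph V}

/-! Homomorphisms extend one vertex at a time, so a finite connected `G` is C-HH exactly when, for
every homomorphism `φ` on a connected induced subgraph `S` and every further vertex `v`, the set
`φ(N(v) ∩ S)` has a common neighbour (`IsCHH.exists_adj_map`, `isCHH_of_exists_adj_map`).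

The listed classes satisfy this for different reasons. In a treelike graph `N(v) ∩ S` lies in one
component, so its image is a clique of fewer than `n` vertices. In class (iii) a single `w ∈ S` is
adjacent to all of `N(v) ∩ S`, and `φ w` serves. In class (iv) the image lies in one part. In class
(v) the image misses an index.

Conversely, a C-HH graph cannot allow `N(v) ∩ S` to be mapped onto a set without common neighbour.
If there is a triangle, the forbidden set is a maximum clique: this excludes induced diamonds and
induced cycles longer than 3, and the maximum cliques are the components of a treelike graph. If
there is none, `G` is bipartite (`IsCHH.exists_coloring`). When (iii) fails, some even induced path
of length at least 4 has ends with a common neighbour, and folding it onto walks gives every two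
vertices of the same colour a common neighbour. When (iv) fails too, a minimal monochromatic set
without common neighbour, together with vertices missing just one of its elements, spans a graph as
in (v); a vertex outside it would yield a forbidden map (`IsCHH.mem_range_of_adj`). -/

/-! ### Connected induced subgraphs -/

theorem induce_connected_of_closed {S : Set V} {r : V} (hr : r ∈ S)
    (h : ∀ T ⊆ S, r ∈ T → (∀ a ∈ T, ∀ b ∈ S, G.Adj a b → b ∈ T) → S ⊆ T) :
    (G.induce S).Connected := by
  have key := h {s | ∃ hs : s ∈ S, (G.induce S).Reachable ⟨r, hr⟩ ⟨s, hs⟩}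
    (fun s hs => hs.1) ⟨hr, Reachable.refl _⟩ (by
      rintro a ⟨ha, hra⟩ b hb hab
      refine ⟨hb, hra.trans (Adj.reachable ?_)⟩
      exact hab)
  rw [connected_iff_exists_forall_reachable]
  exact ⟨⟨r, hr⟩, fun s => (key s.2).2⟩

theorem induce_connected_induction {S : Set V} (hS : (G.induce S).Connected) {P : V → Prop}
    {a : V} (ha : a ∈ S) (hPa : P a)
    (step : ∀ x ∈ S, ∀ y ∈ S, G.Adj x y → P x → P y) : ∀ b ∈ S, P b := by
  intro b hb
  obtain ⟨w⟩ := hS.preconnected ⟨a, ha⟩ ⟨b, hb⟩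
  suffices ∀ (x y : S), (G.induce S).Walk x y → P x → P y from this _ _ w hPa
  intro x y w
  induction w with
  | nil => exact id
  | cons h p ih => exact fun hx => ih (step _ (Subtype.coe_prop _) _ (Subtype.coe_prop _) h hx)

theorem connected_induction (hG : G.Connected) {P : V → Prop} {a : V} (hPa : P a)
    (step : ∀ x y, G.Adj x y → P x → P y) (b : V) : P b := by
  obtain ⟨w⟩ := hG.preconnected a b
  induction w with
  | nil => exact hPa
  | cons h p ih => exact ih (step _ _ h hPa)

theorem exists_adj_of_connected (hG : G.Connected) {a b : V} (hab : a ≠ b) : ∃ c, G.Adj a c := by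
  by_contra! h
  exact hab (connected_induction hG (P := fun x => a = x) rfl
    (fun x y hxy hx => absurd (hx ▸ hxy) (h y)) b)

theorem induce_insert_connected {S : Set V} (hS : (G.induce S).Connected) {s v : V} (hs : s ∈ S)
    (hvs : G.Adj v s) : (G.induce (insert v S)).Connected := by
  refine induce_connected_of_closed (r := s) (Or.inr hs) fun T hT hsT hcl => ?_
  have h1 : ∀ b ∈ S, b ∈ T := induce_connected_induction hS hs hsT
    fun x _ y hy hxy hx => hcl x hx y (Or.inr hy) hxy
  rintro x (rfl | hx)
  · exact hcl s hsT _ (Or.inl rfl) hvs.symm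
  · exact h1 x hx

/-- The vertices of a (not necessarily induced) path span a connected subgraph. -/
theorem induce_path_connected (p : ℕ → V) (m : ℕ) (hp : ∀ i < m, G.Adj (p i) (p (i + 1))) :
    (G.induce (p '' {i | i ≤ m})).Connected := by
  refine induce_connected_of_closed (r := p 0) ⟨0, Nat.zero_le _, rfl⟩ fun T _ h0 hcl => ?_
  rintro _ ⟨i, hi, rfl⟩
  replace hi : i ≤ m := hi
  induction i with
  | zero => exact h0
  | succ i ih => exact hcl _ (ih (by omega)) _ ⟨i + 1, hi, rfl⟩ (hp i (by omega))

/-! ### The one-vertex extension criterion -/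

/-- `φ` preserves the edges inside `S`. -/
def HomOn (G : SimpleGraph V) (S : Set V) (φ : V → V) : Prop :=
  ∀ a ∈ S, ∀ b ∈ S, G.Adj a b → G.Adj (φ a) (φ b)

theorem IsCHH.exists_adj_map [Finite V] (h : IsCHH G) {S : Set V}
    (hS : (G.induce S).Connected) {φ : V → V} (hφ : HomOn G S φ) (v : V) :
    ∃ u, ∀ s ∈ S, G.Adj v s → G.Adj u (φ s) := by
  obtain ⟨ψ, hψ⟩ := h S S.toFinite hS ⟨fun x => φ x, fun {a b} hab => hφ _ a.2 _ b.2 hab⟩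
  refine ⟨ψ v, fun s hs hvs => ?_⟩
  have := ψ.map_adj hvs
  rwa [show ψ s = φ s from hψ ⟨s, hs⟩] at this

-- Induction on the size of the complement. Since `G` is connected, some `v ∉ S` has a neighbour in
-- `S`, so adjoining it keeps the domain connected and the hypothesis supplies its image.
open Classical in
theorem isCHH_of_exists_adj_map [Finite V] (hG : G.Connected)
    (H : ∀ S : Set V, (G.induce S).Connected → ∀ φ : V → V, HomOn G S φ →
      ∀ v ∉ S, ∃ u, ∀ s ∈ S, G.Adj v s → G.Adj u (φ s)) : IsCHH G := by
  have key : ∀ m : ℕ, ∀ S : Set V, Sᶜ.ncard = m → (G.induce S).Connected →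
      ∀ φ : V → V, HomOn G S φ → ∃ ψ : G →g G, ∀ x ∈ S, ψ x = φ x := by
    intro m
    induction m with
    | zero =>
      intro S hm _ φ hφ
      have hS : S = Set.univ := by
        rw [Set.ncard_eq_zero] at hm; exact Set.compl_empty_iff.1 hm
      subst hS
      exact ⟨⟨φ, fun {a b} hab => hφ a trivial b trivial hab⟩, fun _ _ => rfl⟩
    | succ m ih =>
      intro S hm hS φ hφ
      obtain ⟨v, hv, s, hs, hvs⟩ : ∃ v ∉ S, ∃ s ∈ S, G.Adj v s := by
        by_contra! hno
        obtain ⟨⟨r, hr⟩⟩ := hS.nonempty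
        have : S = Set.univ := Set.eq_univ_of_forall
          (connected_induction hG hr fun x y hxy hx => by
            by_contra hy
            exact hno y hy x hx hxy.symm)
        simp [this] at hm
      obtain ⟨u, hu⟩ := H S hS φ hφ v hv
      obtain ⟨ψ, hψ⟩ := ih (insert v S) (by
          have h2 : Sᶜ = insert v (insert v S)ᶜ := by
            ext x
            by_cases hx : x = v
            · simp [hx, hv]
            · simp [hx]
          rw [h2, Set.ncard_insert_of_notMem (by simp)] at hm
          omega) (induce_insert_connected hS hs hvs)
        (Function.update φ v u) (by
          have hne : ∀ x ∈ S, x ≠ v := fun x hx h => hv (h ▸ hx)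
          rintro a (rfl | ha) b (rfl | hb) hab
          · exact absurd hab (G.loopless.irrefl _)
          · simpa [hne b hb] using hu b hb hab
          · simpa [hne a ha] using (hu a ha hab.symm).symm
          · simpa [hne a ha, hne b hb] using hφ a ha b hb hab)
      refine ⟨ψ, fun x hx => ?_⟩
      have hxv : x ≠ v := fun h => hv (h ▸ hx)
      rw [hψ x (Or.inr hx), Function.update_of_ne hxv]
  intro S _ hS φ
  obtain ⟨ψ, hψ⟩ := key _ S rfl hS (fun x => if h : x ∈ S then φ ⟨x, h⟩ else x) (by
    intro a ha b hb hab
    simpa [ha, hb] using φ.map_adj (show (G.induce S).Adj ⟨a, ha⟩ ⟨b, hb⟩ from hab))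
  exact ⟨ψ, fun x => by simpa using hψ x x.2⟩

/-! ### Induced paths, induced cycles and the two-squares graph -/

/-- `p 0, …, p m` is an induced path. -/
structure IsInducedPath (G : SimpleGraph V) (p : ℕ → V) (m : ℕ) : Prop where
  inj : ∀ i j, i < j → j ≤ m → p i ≠ p j
  adj_iff : ∀ i j, i < j → j ≤ m → (G.Adj (p i) (p j) ↔ j = i + 1)

/-- `p 0, …, p (k - 1)` is an induced cycle. -/
structure IsInducedCycle (G : SimpleGraph V) (p : ℕ → V) (k : ℕ) : Prop where
  inj : ∀ i j, i < j → j < k → p i ≠ p j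
  adj_iff : ∀ i j, i < j → j < k → (G.Adj (p i) (p j) ↔ j = i + 1 ∨ (i = 0 ∧ j + 1 = k))

theorem cycleGraph_adj_iff {k : ℕ} {i j : Fin k} (hij : i < j) :
    (cycleGraph k).Adj i j ↔ (j : ℕ) = i + 1 ∨ ((i : ℕ) = 0 ∧ (j : ℕ) + 1 = k) := by
  have hlt : (i : ℕ) < j := hij
  rw [cycleGraph_adj', Fin.coe_sub_iff_le.2 hij.le, Fin.coe_sub_iff_lt.2 hij]
  omega

theorem IsInducedCycle.exists_embedding {p : ℕ → V} {k : ℕ}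
    (h : IsInducedCycle G p k) : ∃ f : cycleGraph k ↪g G, ∀ i, f i = p i := by
  have hinj : Function.Injective fun i : Fin k => p i := by
    intro i j hij
    rcases lt_trichotomy i j with h1 | h1 | h1
    · exact absurd hij (h.inj _ _ h1 j.2)
    · exact h1
    · exact absurd hij.symm (h.inj _ _ h1 i.2)
  refine ⟨⟨⟨fun i => p i, hinj⟩, ?_⟩, fun i => rfl⟩
  intro i j
  rcases lt_trichotomy i j with h1 | rfl | h1
  · rw [cycleGraph_adj_iff h1]; exact h.adj_iff _ _ h1 j.2
  · simp
  · rw [adj_comm, (cycleGraph k).adj_comm, cycleGraph_adj_iff h1]; exact h.adj_iff _ _ h1 i.2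

theorem exists_isInducedCycle {k : ℕ} (hk : 3 ≤ k) (f : cycleGraph k ↪g G) :
    ∃ p, IsInducedCycle G p k ∧ ∀ i : Fin k, f i = p i := by
  have : NeZero k := ⟨by omega⟩
  have hval : ∀ i (h : i < k), Fin.ofNat k i = ⟨i, h⟩ := fun i h => by
    ext; simp [Nat.mod_eq_of_lt h]
  refine ⟨fun i => f (Fin.ofNat k i), ⟨fun i j hij hj h => ?_, fun i j hij hj => ?_⟩, fun i => ?_⟩
  · have := f.injective h
    rw [hval i (by omega), hval j hj, Fin.mk.injEq] at this
    omega
  · rw [f.map_adj_iff, hval i (by omega), hval j hj,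
      cycleGraph_adj_iff (by exact hij)]
  · simp only [hval i i.2]

/-- Two vertices of a connected induced subgraph are joined by an induced path inside it. -/
theorem exists_isInducedPath {S : Set V} (hS : (G.induce S).Connected) {a b : V} (ha : a ∈ S)
    (hb : b ∈ S) : ∃ p m, p 0 = a ∧ p m = b ∧ (∀ i, p i ∈ S) ∧ IsInducedPath G p m := by
  obtain ⟨w, hw⟩ := hS.exists_walk_length_eq_dist ⟨a, ha⟩ ⟨b, hb⟩
  have hd : ∀ i ≤ w.length, (G.induce S).dist ⟨a, ha⟩ (w.getVert i) = i := by
    intro i hi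
    have h1 := dist_le (w.take i)
    have h2 := dist_le (w.drop i)
    have h3 := hS.dist_triangle (u := ⟨a, ha⟩) (v := w.getVert i) (w := ⟨b, hb⟩)
    rw [Walk.take_length] at h1
    rw [Walk.drop_length] at h2
    omega
  refine ⟨fun i => w.getVert i, w.length, by simp, by simp, fun i => Subtype.coe_prop _,
    fun i j hij hj h => ?_, fun i j hij hj => ⟨fun h => ?_, ?_⟩⟩
  · have := congrArg ((G.induce S).dist ⟨a, ha⟩) (Subtype.ext h)
    rw [hd i (by omega), hd j hj] at this
    omega
  · have h' : (G.induce S).Adj (w.getVert i) (w.getVert j) := h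
    have h3 := hS.dist_triangle (u := ⟨a, ha⟩) (v := w.getVert i) (w := w.getVert j)
    rw [hd i (by omega), hd j hj, dist_eq_one_iff_adj.2 h'] at h3
    omega
  · rintro rfl
    exact w.adj_getVert_succ (by omega)

/-- Consecutive neighbours on an induced path `p` of a vertex `v` outside it give an induced
cycle. -/
theorem IsInducedPath.isInducedCycle {p : ℕ → V} {m : ℕ} (hp : IsInducedPath G p m) {v : V}
    {i j : ℕ} (hij : i < j) (hj : j ≤ m) (hv : ∀ l, i ≤ l → l ≤ j → p l ≠ v)
    (hvi : G.Adj v (p i)) (hvj : G.Adj v (p j)) (hvl : ∀ l, i < l → l < j → ¬ G.Adj v (p l)) :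
    IsInducedCycle G (fun l => if l = 0 then v else p (i + l - 1)) (j - i + 2) := by
  constructor
  · intro a b hab hb
    have hb0 : b ≠ 0 := by omega
    by_cases ha : a = 0
    · simpa [ha, hb0] using (hv (i + b - 1) (by omega) (by omega)).symm
    · simpa [ha, hb0] using hp.inj (i + a - 1) (i + b - 1) (by omega) (by omega)
  · intro a b hab hb
    have hb0 : b ≠ 0 := by omega
    by_cases ha : a = 0
    · simp only [ha, hb0, if_true, if_false]
      by_cases h1 : b = 1
      · subst h1; simpa using hvi
      by_cases h2 : b = j - i + 1
      · subst h2
        have : i + (j - i + 1) - 1 = j := by omega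
        rw [this]
        simp [hvj]
      · have := hvl (i + b - 1) (by omega) (by omega)
        simp only [this, false_iff]; omega
    · simp only [ha, hb0, if_false, false_and, or_false]
      rw [hp.adj_iff _ _ (by omega) (by omega)]
      omega

theorem twoSquares_adj {i j : Fin 6} : twoSquares.Adj i j ↔
    (i - j).val = 1 ∨ (j - i).val = 1 ∨ i = 2 ∧ j = 5 ∨ i = 5 ∧ j = 2 := by
  have h : (2 : Fin 6) ≠ 5 := by decide
  simp only [twoSquares, sup_adj, cycleGraph_adj', edge_adj]
  constructor
  · rintro (h1 | ⟨h1 | h1, -⟩) <;> tauto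
  · rintro (h1 | h1 | ⟨rfl, rfl⟩ | ⟨rfl, rfl⟩) <;> simp_all

instance : DecidableRel twoSquares.Adj := fun _ _ => decidable_of_iff' _ twoSquares_adj

theorem twoSquares_isIndContained {f : Fin 6 → V}
    (h : ∀ i j, i < j → (G.Adj (f i) (f j) ↔ twoSquares.Adj i j)) :
    twoSquares.IsIndContained G := by
  have h' : ∀ i j, G.Adj (f i) (f j) ↔ twoSquares.Adj i j := by
    intro i j
    rcases lt_trichotomy i j with h1 | rfl | h1
    · exact h i j h1
    · simp
    · rw [adj_comm, twoSquares.adj_comm]; exact h j i h1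
  -- No two vertices of the two-squares graph have the same neighbourhood, so matching adjacencies
  -- already force `f` to be injective.
  have twin : ∀ i j : Fin 6, (∀ k, twoSquares.Adj i k ↔ twoSquares.Adj j k) → i = j := by decide
  refine ⟨⟨⟨f, fun i j hij => twin i j fun k => ?_⟩, h' _ _⟩⟩
  rw [← h', ← h', hij]

theorem twoSquares_isIndContained_of_adj {a b c d e v : V}
    (hab : G.Adj a b) (hbc : G.Adj b c) (hcd : G.Adj c d) (hde : G.Adj d e) (hev : G.Adj e v)
    (hav : G.Adj a v) (hcv : G.Adj c v) (hac : ¬ G.Adj a c) (had : ¬ G.Adj a d)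
    (hae : ¬ G.Adj a e) (hbd : ¬ G.Adj b d) (hbe : ¬ G.Adj b e) (hbv : ¬ G.Adj b v)
    (hce : ¬ G.Adj c e) (hdv : ¬ G.Adj d v) : twoSquares.IsIndContained G := by
  refine twoSquares_isIndContained (f := ![a, b, c, d, e, v]) ?_
  have e1 : ∀ {i j : Fin 6} {P : Prop}, P → twoSquares.Adj i j → (P ↔ twoSquares.Adj i j) :=
    fun h1 h2 => ⟨fun _ => h2, fun _ => h1⟩
  have e2 : ∀ {i j : Fin 6} {P : Prop}, ¬ P → ¬ twoSquares.Adj i j → (P ↔ twoSquares.Adj i j) :=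
    fun h1 h2 => ⟨fun h => absurd h h1, fun h => absurd h h2⟩
  intro i j hij
  fin_cases i <;> fin_cases j <;> first
    | exact absurd hij (by decide)
    | exact e1 (by assumption) (by decide)
    | exact e2 (by assumption) (by decide)

theorem isInducedCycle_three {a b c : V} (hab : G.Adj a b) (hbc : G.Adj b c) (hac : G.Adj a c) :
    IsInducedCycle G (fun i => if i = 0 then a else if i = 1 then b else c) 3 := by
  have h := hab.ne
  have h2 := hbc.ne
  have h3 := hac.ne
  constructor
  · intro i j hij hj
    interval_cases j <;> interval_cases i <;> simpa
  · intro i j hij hj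
    interval_cases j <;> interval_cases i <;> simpa

/-! ### Sufficiency: the listed classes are C-HH -/

open Classical in
theorem IsTreelike.isCHH [Finite V] {n : ℕ} (h : IsTreelike n G) : IsCHH G := by
  obtain ⟨hG, 𝒞, hcl, hcov, hedge, huniq, hcyc⟩ := h
  have huniq' : ∀ C ∈ 𝒞, ∀ D ∈ 𝒞, ∀ u w, u ≠ w → u ∈ C → w ∈ C → u ∈ D → w ∈ D → C = D := by
    intro C hC D hD u w huw h1 h2 h3 h4
    by_contra hne
    exact huw (huniq C hC D hD hne u w h1 h3 h2 h4)
  -- A triangle is an induced 3-cycle, hence inside one component; so every clique lies in a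
  -- component, and one with fewer than `n` vertices leaves a vertex of that component over.
  have hclique : ∀ I : Finset V, G.IsClique I → I.Nonempty → I.card < n →
      ∃ u, ∀ a ∈ I, G.Adj u a := by
    rintro I hI ⟨a, ha⟩ hcard
    obtain ⟨D, hD, hID⟩ : ∃ D ∈ 𝒞, I ⊆ D := by
      by_cases hb : ∃ b ∈ I, b ≠ a
      · obtain ⟨b, hb, hba⟩ := hb
        have hab := hI ha hb hba.symm
        obtain ⟨D, hD, haD, hbD⟩ := hedge a b hab
        refine ⟨D, hD, fun x hx => ?_⟩
        by_cases hxa : x = a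
        · rwa [hxa]
        by_cases hxb : x = b
        · rwa [hxb]
        obtain ⟨f, hf⟩ := (isInducedCycle_three hab (hI hb hx (Ne.symm hxb))
          (hI ha hx (Ne.symm hxa))).exists_embedding
        obtain ⟨E, hE, hfE⟩ := hcyc 3 le_rfl f
        have h0 := hfE 0
        have h1 := hfE 1
        have h2 := hfE 2
        simp only [hf] at h0 h1 h2
        rw [huniq' D hD E hE a b hab.ne haD hbD (by simpa using h0) (by simpa using h1)]
        simpa using h2
      · push Not at hb
        obtain ⟨D, hD, haD⟩ := hcov a
        exact ⟨D, hD, fun x hx => by rwa [hb x hx]⟩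
    obtain ⟨u, huD, huI⟩ := Finset.exists_mem_notMem_of_card_lt_card
      (show I.card < D.card by rwa [(hcl D hD).card_eq])
    exact ⟨u, fun x hx => (hcl D hD).isClique huD (hID hx) fun h => huI (h ▸ hx)⟩
  refine isCHH_of_exists_adj_map hG fun S hS φ hφ v hv => ?_
  by_cases hs0 : ∃ s ∈ S, G.Adj v s
  swap
  · push Not at hs0
    exact ⟨v, fun s hs h => absurd h (hs0 s hs)⟩
  obtain ⟨s0, hs0, hvs0⟩ := hs0
  obtain ⟨C, hC, hvC, hsC⟩ := hedge v s0 hvs0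
  have hNC : ∀ s ∈ S, G.Adj v s → s ∈ C := by
    intro s hs hvs
    obtain ⟨p, m, rfl, rfl, hpS, hp⟩ := exists_isInducedPath hS hs0 hs
    suffices ∀ i ≤ m, G.Adj v (p i) → p i ∈ C from this m le_rfl hvs
    intro i
    induction i using Nat.strong_induction_on with
    | _ i ih =>
    intro him hvi
    rcases Nat.eq_zero_or_pos i with rfl | hi
    · exact hsC
    -- The last neighbour of `v` on the path before `p i`; the default value 0 is harmless because
    -- `p 0` is itself a neighbour. The induced cycle through `v`, `p j`, `p i` lies in a component
    -- sharing `v` and `p j` with `C`, hence in `C`.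
    set j := Nat.findGreatest (fun j => G.Adj v (p j)) (i - 1)
    have hvj : G.Adj v (p j) :=
      Nat.findGreatest_spec (P := fun j => G.Adj v (p j)) (Nat.zero_le _) hvs0
    have hji : j ≤ i - 1 := Nat.findGreatest_le _
    have hgr : ∀ l, j < l → l < i → ¬ G.Adj v (p l) := fun l h1 h2 =>
      Nat.findGreatest_is_greatest (P := fun j => G.Adj v (p j)) h1 (by omega)
    have hc := hp.isInducedCycle (v := v) (i := j) (j := i) (by omega) him
      (fun l _ _ h => hv (h ▸ hpS l)) hvj hvi hgr
    obtain ⟨f, hf⟩ := hc.exists_embedding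
    obtain ⟨E, hE, hfE⟩ := hcyc _ (by omega) f
    have h0 := hfE ⟨0, by omega⟩
    have h1 := hfE ⟨1, by omega⟩
    have h2 := hfE ⟨i - j + 1, by omega⟩
    simp only [hf, if_true, one_ne_zero, if_false, Nat.add_sub_cancel] at h0 h1
    rw [hf] at h2
    simp only [Nat.succ_ne_zero, if_false, show j + (i - j + 1) - 1 = i by omega] at h2
    rwa [huniq' C hC E hE v (p j) hvj.ne hvC (ih j (by omega) (by omega) hvj) h0 h1]
  have hT : S.Finite := S.toFinite
  let T := hT.toFinset.filter fun s => G.Adj v s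
  have hTS : ∀ s, s ∈ T ↔ s ∈ S ∧ G.Adj v s := fun s => by simp [T]
  obtain ⟨u, hu⟩ := hclique (T.image φ) (by
    intro a ha b hb hab
    simp only [Finset.coe_image, Set.mem_image, Finset.mem_coe, hTS] at ha hb
    obtain ⟨s, ⟨hs, hvs⟩, rfl⟩ := ha
    obtain ⟨t, ⟨ht, hvt⟩, rfl⟩ := hb
    exact hφ s hs t ht ((hcl C hC).isClique (hNC s hs hvs) (hNC t ht hvt)
      fun h => hab (h ▸ rfl)))
    ⟨φ s0, Finset.mem_image_of_mem _ ((hTS _).2 ⟨hs0, hvs0⟩)⟩ (by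
      have h1 : T ⊂ C := by
        refine ⟨fun s hs => hNC s ((hTS s).1 hs).1 ((hTS s).1 hs).2, fun h => ?_⟩
        exact G.loopless.irrefl _ ((hTS v).1 (h hvC)).2
      have := Finset.card_lt_card h1
      rw [(hcl C hC).card_eq] at this
      exact Finset.card_image_le.trans_lt this)
  exact ⟨u, fun s hs hvs => hu _ (Finset.mem_image_of_mem _ ((hTS _).2 ⟨hs, hvs⟩))⟩

theorem AllInducedCyclesSquares.eq_four {p : ℕ → V} {k : ℕ} (h : AllInducedCyclesSquares G)
    (hk : 3 ≤ k) (hp : IsInducedCycle G p k) : k = 4 :=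
  h k hk ⟨hp.exists_embedding.choose⟩

/-- Consecutive neighbours of `v` along an induced path from `a` to `c` are exactly two steps apart,
as they close up to a square. A path longer than 2 would therefore put two squares side by side, so
its midpoint is the required `w`. -/
theorem AllInducedCyclesSquares.exists_adj_adj (h : AllInducedCyclesSquares G)
    (h2 : ¬ twoSquares.IsIndContained G) {S : Set V} (hS : (G.induce S).Connected) {v : V}
    (hv : v ∉ S) {a c : V} (ha : a ∈ S) (hc : c ∈ S) (hva : G.Adj v a) (hvc : G.Adj v c)
    (hac : a ≠ c) : ∃ w ∈ S, G.Adj w a ∧ G.Adj w c := by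
  classical
  obtain ⟨p, m, rfl, rfl, hpS, hp⟩ := exists_isInducedPath hS ha hc
  have step : ∀ j < m, G.Adj v (p j) → j + 2 ≤ m ∧ G.Adj v (p (j + 2)) ∧
      ¬ G.Adj v (p (j + 1)) := by
    intro j hj hvj
    have hex : ∃ i, j < i ∧ i ≤ m ∧ G.Adj v (p i) := ⟨m, hj, le_rfl, hvc⟩
    obtain ⟨h3, h4, h5⟩ := Nat.find_spec hex
    have hmin : ∀ l, j < l → l < Nat.find hex → ¬ G.Adj v (p l) := fun l h6 h7 h8 =>
      Nat.find_min hex h7 ⟨h6, by omega, h8⟩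
    have h6 := h.eq_four (by omega) (hp.isInducedCycle (v := v) h3 h4
      (fun l _ _ h => hv (h ▸ hpS l)) hvj h5 hmin)
    have h7 : Nat.find hex = j + 2 := by omega
    rw [h7] at h4 h5 hmin
    exact ⟨h4, h5, hmin _ (by omega) (by omega)⟩
  have hm : 0 < m := Nat.pos_of_ne_zero fun h => hac (by rw [h])
  obtain ⟨hm2, hv2, hv1⟩ := step 0 hm hva
  rcases hm2.eq_or_lt with hm2 | hm2
  · refine ⟨p 1, hpS 1, ((hp.adj_iff 0 1 one_pos hm).2 rfl).symm, ?_⟩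
    rw [← hm2]
    exact (hp.adj_iff 1 2 (by omega) (by omega)).2 rfl
  · obtain ⟨hm4, hv4, hv3⟩ := step 2 hm2 hv2
    refine absurd (twoSquares_isIndContained_of_adj (a := p 0) (b := p 1) (c := p 2) (d := p 3)
      (e := p 4) (v := v) ?_ ?_ ?_ ?_ hv4.symm hva.symm hv2.symm ?_ ?_ ?_ ?_ ?_
      (fun h => hv1 h.symm) ?_ (fun h => hv3 h.symm)) h2 <;>
    · rw [hp.adj_iff _ _ (by omega) (by omega)]
      try omega

theorem AllInducedCyclesSquares.isCHH [Finite V] (hG : G.Connected)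
    (h : AllInducedCyclesSquares G) (h2 : ¬ twoSquares.IsIndContained G) : IsCHH G := by
  have hT : ∀ {a b c}, G.Adj a b → G.Adj b c → ¬ G.Adj a c := fun hab hbc hac => by
    simpa using h.eq_four le_rfl (isInducedCycle_three hab hbc hac)
  refine isCHH_of_exists_adj_map hG fun S hS φ hφ v hv => ?_
  by_cases hac : ∃ a ∈ S, ∃ c ∈ S, G.Adj v a ∧ G.Adj v c ∧ a ≠ c
  · obtain ⟨a, ha, c, hc, hva, hvc, hac⟩ := hac
    obtain ⟨w0, hw0, hwa, -⟩ := h.exists_adj_adj h2 hS hv ha hc hva hvc hac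
    let N : V → Set V := fun w => {z | z ∈ S ∧ G.Adj v z ∧ G.Adj w z}
    -- The vertex of `S` adjacent to the most neighbours of `v` is adjacent to all of them: if it
    -- misses `c`, a rival `w'` adjacent to `a` and `c` must by maximality miss some `b ∈ N w`, and
    -- `b, w, a, w', c, v` form two squares.
    obtain ⟨w, hw, hmax⟩ := Set.exists_max_image S (fun w => (N w).ncard) S.toFinite ⟨w0, hw0⟩
    obtain ⟨a, ha, hva, hwa⟩ : (N w).Nonempty := by
      rw [← Set.ncard_pos]
      exact ((Set.ncard_pos (s := N w0)).2 ⟨a, ha, hva, hwa⟩).trans_le (hmax w0 hw0)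
    have hcover : ∀ c ∈ S, G.Adj v c → G.Adj w c := by
      intro c hc hvc
      by_contra hwc
      obtain ⟨w', hw', hwa', hwc'⟩ := h.exists_adj_adj h2 hS hv ha hc hva hvc
        (fun h => hwc (h ▸ hwa))
      obtain ⟨b, ⟨hb, hvb, hwb⟩, hwb'⟩ : ∃ b ∈ N w, ¬ G.Adj w' b := by
        by_contra! hno
        have : N w ⊂ N w' :=
          ⟨fun z hz => ⟨hz.1, hz.2.1, hno z hz⟩, fun hsub => hwc (hsub ⟨hc, hvc, hwc'⟩).2.2⟩
        exact absurd (hmax w' hw') (not_le.2 (Set.ncard_lt_ncard this))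
      exact h2 (twoSquares_isIndContained_of_adj (a := b) (b := w) (c := a) (d := w') (e := c)
        (v := v) hwb.symm hwa hwa'.symm hwc' hvc.symm hvb.symm hva.symm
        (hT hvb.symm hva) (fun h => hwb' h.symm) (hT hvb.symm hvc)
        (hT hwa hwa'.symm) hwc (hT hwa hva.symm) (hT hva.symm hvc) (hT hwa' hva.symm))
    exact ⟨φ w, fun s hs hvs => hφ w hw s hs (hcover s hs hvs)⟩
  · push Not at hac
    by_cases hs : ∃ s ∈ S, G.Adj v s
    · obtain ⟨s, hs, hvs⟩ := hs
      obtain ⟨u, hu⟩ : ∃ u, G.Adj (φ s) u := by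
        by_cases h1 : φ s = v
        · exact ⟨s, h1 ▸ hvs⟩
        · exact exists_adj_of_connected hG h1
      exact ⟨u, fun t ht hvt => by rw [← hac s hs t ht hvs hvt]; exact hu.symm⟩
    · push Not at hs
      exact ⟨v, fun s h h' => absurd h' (hs s h)⟩

/-- In a graph with a proper colouring by two colours, homomorphisms from connected induced
subgraphs respect the relation of having the same colour. -/
theorem HomOn.color_iff {c : V → Prop} (hc : ∀ a b, G.Adj a b → (c a ↔ ¬ c b)) {S : Set V}
    (hS : (G.induce S).Connected) {φ : V → V} (hφ : HomOn G S φ) {s t : V} (hs : s ∈ S)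
    (ht : t ∈ S) : (c s ↔ c t) ↔ (c (φ s) ↔ c (φ t)) := by
  refine induce_connected_induction hS (P := fun t => (c s ↔ c t) ↔ (c (φ s) ↔ c (φ t))) hs
    (by simp) (fun x hx y hy hxy h => ?_) t ht
  have h1 := hc x y hxy
  have h2 := hc _ _ (hφ x hx y hy hxy)
  tauto

theorem IsBipartiteWithCommonNeighbours.isCHH [Finite V] (hG : G.Connected)
    (h : IsBipartiteWithCommonNeighbours G) : IsCHH G := by
  obtain ⟨X, Y, hXY, hu, ⟨x, hx⟩, y, hy⟩ := h
  have hc : ∀ a b, G.Adj a b → (a ∈ X ↔ ¬ b ∈ X) := by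
    intro a b hab
    have := Set.disjoint_left.1 hXY.disjoint
    rcases hXY.mem_of_adj hab with ⟨h1, h2⟩ | ⟨h1, h2⟩
    · exact ⟨fun _ h3 => this h3 h2, fun _ => h1⟩
    · exact ⟨fun h3 => absurd h1 (this h3), fun h3 => absurd h2 h3⟩
  refine isCHH_of_exists_adj_map hG fun S hS φ hφ v hv => ?_
  have hcol : ∀ s ∈ S, ∀ t ∈ S, G.Adj v s → G.Adj v t → (φ s ∈ X ↔ φ t ∈ X) := by
    intro s hs t ht hvs hvt
    refine (hφ.color_iff (c := fun x => x ∈ X) hc hS hs ht).1 ?_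
    have := hc _ _ hvs
    have := hc _ _ hvt
    tauto
  by_cases hX : ∃ s ∈ S, G.Adj v s ∧ φ s ∈ X
  · obtain ⟨s, hs, hvs, hsX⟩ := hX
    exact ⟨x, fun t ht hvt => hx _ ((hcol s hs t ht hvs hvt).1 hsX)⟩
  · push Not at hX
    refine ⟨y, fun t ht hvt => hy _ ?_⟩
    exact ((Set.ext_iff.1 hu (φ t)).2 trivial).resolve_left (hX t ht hvt)

/-- The index of a vertex of the bipartite complement of a perfect matching. -/
def idx {n : ℕ} : Fin n ⊕ Fin n → Fin n := Sum.elim id id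

theorem bipartiteComplementMatching_adj {n : ℕ} {a b : Fin n ⊕ Fin n} :
    (bipartiteComplementMatching n).Adj a b ↔ a.isLeft ≠ b.isLeft ∧ idx a ≠ idx b := by
  rcases a with a | a <;> rcases b with b | b <;>
    simp [bipartiteComplementMatching, idx, eq_comm]

theorem isCHH_of_iso_bipartiteComplementMatching [Finite V] (hG : G.Connected) {n : ℕ}
    (e : G ≃g bipartiteComplementMatching n) : IsCHH G := by
  have hadj : ∀ a b, G.Adj a b ↔ (e a).isLeft ≠ (e b).isLeft ∧ idx (e a) ≠ idx (e b) :=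
    fun a b => by rw [← e.map_adj_iff, bipartiteComplementMatching_adj]
  have hc : ∀ a b, G.Adj a b → ((e a).isLeft ↔ ¬ (e b).isLeft) := by
    intro a b hab
    have := ((hadj a b).1 hab).1
    revert this
    cases (e a).isLeft <;> cases (e b).isLeft <;> simp
  have hmk : ∀ (l : Bool) (k : Fin n), ∃ u, (e u).isLeft = l ∧ idx (e u) = k := by
    intro l k
    cases l
    · exact ⟨e.symm (Sum.inr k), by simp [idx]⟩
    · exact ⟨e.symm (Sum.inl k), by simp [idx]⟩
  refine isCHH_of_exists_adj_map hG fun S hS φ hφ v hv => ?_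
  choose t ht using fun k => hmk (!(e v).isLeft) k
  -- Neighbours of `v` avoid its index, so their images use at most `n - 1` indices; the new image
  -- takes a missing index `k`.
  obtain ⟨k, -, hk⟩ := Finset.exists_mem_notMem_of_card_lt_card
    (show ((Finset.univ.erase (idx (e v))).image fun i => idx (e (φ (t i)))).card <
      (Finset.univ : Finset (Fin n)).card from Finset.card_image_le.trans_lt
        (Finset.card_erase_lt_of_mem (Finset.mem_univ _)))
  by_cases hs0 : ∃ s ∈ S, G.Adj v s
  swap
  · push Not at hs0
    exact ⟨v, fun s hs h => absurd h (hs0 s hs)⟩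
  obtain ⟨s0, hs0, hvs0⟩ := hs0
  obtain ⟨u, hul, huk⟩ := hmk (!(e (φ s0)).isLeft) k
  refine ⟨u, fun s hs hvs => (hadj _ _).2 ⟨?_, ?_⟩⟩
  · have h1 := (hφ.color_iff (c := fun x => (e x).isLeft = true) hc hS hs0 hs).1 (by
      have := hc _ _ hvs
      have := hc _ _ hvs0
      tauto)
    rw [hul]
    cases h3 : (e (φ s0)).isLeft <;> cases h4 : (e (φ s)).isLeft <;> simp_all
  · rw [huk]
    rintro rfl
    obtain ⟨h1, h2⟩ := (hadj _ _).1 hvs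
    refine hk (Finset.mem_image.2 ⟨idx (e s), by simpa using h2.symm, ?_⟩)
    have : t (idx (e s)) = s := by
      apply e.injective
      obtain ⟨h3, h4⟩ := ht (idx (e s))
      generalize e (t (idx (e s))) = a at h3 h4
      generalize e s = b at *
      rcases a with a | a <;> rcases b with b | b <;> simp_all [idx]
    rw [this]

/-! ### Prescribed maps and maximum cliques -/

theorem exists_map_eq {p : ℕ → V} {s : Set ℕ} (hp : Set.InjOn p s) (g : ℕ → V) :
    ∃ φ : V → V, (∀ i ∈ s, φ (p i) = g i) ∧ ∀ x ∉ p '' s, φ x = x := by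
  classical
  refine ⟨fun x => if h : ∃ i ∈ s, p i = x then g h.choose else x, fun i hi => ?_, fun x hx => ?_⟩
  · have h : ∃ j ∈ s, p j = p i := ⟨i, hi, rfl⟩
    have := hp h.choose_spec.1 hi h.choose_spec.2
    simp only [dif_pos h, this]
  · exact dif_neg hx

theorem exists_bijOn_of_card_eq [Nonempty V] {A B : Finset V} (h : A.card = B.card) :
    ∃ φ : V → V, Set.BijOn φ A B :=
  A.finite_toSet.exists_bijOn_of_encard_eq (by simp [h])

theorem induce_clique_connected {S : Set V} (hS : G.IsClique S) {a : V} (ha : a ∈ S) :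
    (G.induce S).Connected :=
  induce_connected_of_closed ha fun T _ haT hcl x hx => by
    by_cases h : a = x
    · exact h ▸ haT
    · exact hcl a haT x hx (hS ha hx h)

theorem not_forall_adj_of_isNClique {n : ℕ}
    (hmax : ∀ T : Finset V, G.IsClique T → T.card ≤ n)
    {Q : Finset V} (hQ : G.IsNClique n Q) (u : V) : ¬ ∀ x ∈ Q, G.Adj u x := by
  classical
  intro hu
  have := hmax (insert u Q) (by
    rw [Finset.coe_insert]
    exact hQ.isClique.insert fun x hx _ => hu x hx)
  rw [Finset.card_insert_of_notMem fun h => G.loopless.irrefl _ (hu u h), hQ.card_eq] at this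
  omega

/-! ### Necessity with a triangle: treelike graphs -/

section Triangle

variable [Finite V] {n : ℕ}

/-- Were a maximal clique `E` smaller than `Q`, a bijection from part of `Q` onto `E` would send a
further vertex of `Q` to a vertex adjacent to all of `E`. -/
theorem IsCHH.exists_isNClique_superset (h : IsCHH G) {Q : Finset V} (hQ : G.IsNClique n Q)
    (hmax : ∀ T : Finset V, G.IsClique T → T.card ≤ n) {A : Finset V} (hA : G.IsClique A)
    (hne : A.Nonempty) : ∃ E, A ⊆ E ∧ G.IsNClique n E := by
  classical
  obtain ⟨E, hAE, hE⟩ := Finite.exists_le_maximal (p := fun T : Finset V => G.IsClique T) hA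
  refine ⟨E, hAE, hE.prop, (hmax E hE.prop).antisymm (le_of_not_gt fun hlt => ?_)⟩
  obtain ⟨a, ha⟩ := hne
  have : Nonempty V := ⟨a⟩
  obtain ⟨B, hBQ, hB⟩ := Finset.exists_subset_card_eq (s := Q) (n := E.card)
    (by rw [hQ.card_eq]; exact hlt.le)
  obtain ⟨φ, hφ⟩ := exists_bijOn_of_card_eq hB
  obtain ⟨v, hvQ, hvB⟩ := Finset.exists_mem_notMem_of_card_lt_card
    (show B.card < Q.card by rw [hB, hQ.card_eq]; exact hlt)
  have hBc : G.IsClique (B : Set V) := hQ.isClique.subset hBQ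
  obtain ⟨b, hb, -⟩ := hφ.surjOn (hAE ha)
  obtain ⟨u, hu⟩ := h.exists_adj_map (induce_clique_connected hBc hb) (φ := φ)
    (fun x hx y hy hxy => hE.prop (hφ.mapsTo hx) (hφ.mapsTo hy) (hφ.injOn.ne hx hy hxy.ne)) v
  have hu' : ∀ x ∈ E, G.Adj u x := by
    intro x hx
    obtain ⟨b, hb, rfl⟩ := hφ.surjOn hx
    exact hu b hb (hQ.isClique hvQ (hBQ hb) fun h => hvB (h ▸ hb))
  have hins : G.IsClique (insert u E : Finset V) := by
    rw [Finset.coe_insert]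
    exact hE.prop.insert fun x hx _ => hu' x hx
  exact G.loopless.irrefl _ (hu' u (hE.le_of_ge hins (Finset.subset_insert u E)
    (Finset.mem_insert_self u E)))

/-- This excludes induced diamonds. If `c` is outside an `n`-clique `E` containing `v, a, b`, then
`E` with `v` replaced by `c` consists of `n` neighbours of `v` and is connected through `b`. Any
bijection onto the clique `Q` is a homomorphism, and the image of `v` would enlarge `Q`. -/
theorem IsCHH.adj_of_adj_adj (h : IsCHH G) {Q : Finset V} (hQ : G.IsNClique n Q)
    (hmax : ∀ T : Finset V, G.IsClique T → T.card ≤ n) {v a b c : V} (hva : G.Adj v a)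
    (hvb : G.Adj v b) (hvc : G.Adj v c) (hab : G.Adj a b) (hbc : G.Adj b c) (hac : a ≠ c) :
    G.Adj a c := by
  classical
  have : Nonempty V := ⟨v⟩
  obtain ⟨E, hE, hEn⟩ := h.exists_isNClique_superset hQ hmax (A := {v, a, b}) (by
    simp [isClique_insert, hva, hvb, hab]) ⟨v, by simp⟩
  have hvE : v ∈ E := hE (by simp)
  have haE : a ∈ E := hE (by simp)
  have hbE : b ∈ E := hE (by simp)
  by_cases hcE : c ∈ E
  · exact hEn.isClique haE hcE hac
  exfalso
  obtain ⟨φ, hφ⟩ := exists_bijOn_of_card_eq (A := insert c (E.erase v)) (B := Q) (by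
    rw [Finset.card_insert_of_notMem (by simp [hcE]), Finset.card_erase_add_one hvE, hEn.card_eq,
      hQ.card_eq])
  have hbS : b ∈ E.erase v := Finset.mem_erase.2 ⟨hvb.ne', hbE⟩
  have hS := induce_insert_connected (induce_clique_connected (G := G)
    (S := (E.erase v : Finset V)) (hEn.isClique.subset (Finset.erase_subset _ _)) hbS) hbS hbc.symm
  rw [← Finset.coe_insert] at hS
  obtain ⟨u, hu⟩ := h.exists_adj_map hS (φ := φ) (fun x hx y hy hxy =>
    hQ.isClique (hφ.mapsTo hx) (hφ.mapsTo hy) (hφ.injOn.ne hx hy hxy.ne)) v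
  refine not_forall_adj_of_isNClique hmax hQ u fun x hx => ?_
  obtain ⟨s, hs, rfl⟩ := hφ.surjOn hx
  refine hu s hs ?_
  rcases Finset.mem_insert.1 hs with rfl | hs
  · exact hvc
  · obtain ⟨h1, h2⟩ := Finset.mem_erase.1 hs
    exact hEn.isClique hvE h2 h1.symm

/-- Let `E` be an `n`-clique on the edge `p 0, p 1`. Fixing `E` without `p 0` and folding the rest
of the cycle into `E` so that `p (k - 1)` goes to `p 0` makes the image of `p 0` adjacent to all of
`E`. -/
theorem IsCHH.not_isInducedCycle (h : IsCHH G) {Q : Finset V} (hQ : G.IsNClique n Q) (hn : 3 ≤ n)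
    (hmax : ∀ T : Finset V, G.IsClique T → T.card ≤ n) (k : ℕ) :
    4 ≤ k → ∀ p, ¬ IsInducedCycle G p k := by
  classical
  induction k using Nat.strong_induction_on with
  | _ k ih =>
  intro hk p hp
  have h01 : G.Adj (p 0) (p 1) := (hp.adj_iff 0 1 (by omega) (by omega)).2 (Or.inl rfl)
  obtain ⟨E, hE, hEn⟩ := h.exists_isNClique_superset hQ hmax (A := {p 0, p 1}) (by
    simp [isClique_insert, h01]) ⟨p 0, by simp⟩
  have h0E : p 0 ∈ E := hE (by simp)
  have h1E : p 1 ∈ E := hE (by simp)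
  have hlast : G.Adj (p 0) (p (k - 1)) :=
    (hp.adj_iff 0 (k - 1) (by omega) (by omega)).2 (Or.inr ⟨rfl, by omega⟩)
  have hsucc : ∀ i, i + 1 < k → G.Adj (p i) (p (i + 1)) := fun i hi =>
    (hp.adj_iff i (i + 1) (by omega) hi).2 (Or.inl rfl)
  have hpE : ∀ i, 2 ≤ i → i < k → p i ∉ E := by
    intro i hi hik hiE
    have h1 := (hp.adj_iff 0 i (by omega) hik).1
      (hEn.isClique h0E hiE (hp.inj 0 i (by omega) hik))
    have h2 := (hp.adj_iff 1 i (by omega) hik).1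
      (hEn.isClique h1E hiE (hp.inj 1 i (by omega) hik))
    omega
  -- At `i = 2` and `i = k - 1` such an edge creates a diamond; at the first `i` in between it
  -- closes an induced cycle of length `i + 1 < k`, excluded by induction.
  have hnadj : ∀ x ∈ E, x ≠ p 0 → x ≠ p 1 → ∀ i, 2 ≤ i → i < k → ¬ G.Adj x (p i) := by
    intro x hx hx0 hx1 i
    have ax0 := hEn.isClique h0E hx hx0.symm
    have ax1 := hEn.isClique h1E hx hx1.symm
    induction i using Nat.strong_induction_on with
    | _ i ihi =>
    intro hi hik hadj
    by_cases hi2 : i = 2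
    · subst hi2
      have := h.adj_of_adj_adj hQ hmax h01.symm ax1 (hsucc 1 (by omega)) ax0 hadj
        (hp.inj 0 2 (by omega) hik)
      rw [hp.adj_iff 0 2 (by omega) hik] at this
      omega
    by_cases hil : i = k - 1
    · subst hil
      have := h.adj_of_adj_adj hQ hmax h01 ax0 hlast ax1 hadj
        (hp.inj 1 (k - 1) (by omega) hik)
      rw [hp.adj_iff 1 (k - 1) (by omega) hik] at this
      omega
    have hpath : IsInducedPath G (fun l => p (l + 1)) (i - 1) :=
      ⟨fun a b hab hb => hp.inj _ _ (by omega) (by omega), fun a b hab hb => by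
        rw [hp.adj_iff _ _ (by omega) (by omega)]; omega⟩
    refine ih _ ?_ ?_ _ (hpath.isInducedCycle (v := x) (i := 0) (j := i - 1) (by omega) le_rfl
      ?_ ax1.symm ?_ ?_)
    · omega
    · omega
    · intro l _ hl hlx
      rcases Nat.eq_zero_or_pos l with rfl | hl0
      · exact hx1 hlx.symm
      · exact hpE (l + 1) (by omega) (by omega) (hlx ▸ hx)
    · rwa [show i - 1 + 1 = i by omega]
    · exact fun l hl hli => ihi (l + 1) (by omega) (by omega) (by omega)
  obtain ⟨e, heE, he⟩ := Finset.exists_mem_notMem_of_card_lt_card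
    (show ({p 0, p 1} : Finset V).card < E.card by
      rw [hEn.card_eq]; exact Finset.card_le_two.trans_lt hn)
  have he0 : e ≠ p 0 := fun h => he (by simp [h])
  have he1 : e ≠ p 1 := fun h => he (by simp [h])
  have ae0 := hEn.isClique h0E heE he0.symm
  have ae1 := hEn.isClique h1E heE he1.symm
  -- The path alternates between `e` and `p 1`, both adjacent to `p 0`, so it can end at `p 0`
  -- whatever the parity of `k`. The third vertex `e` exists because `n ≥ 3`.
  let g : ℕ → V := fun i => if i = k - 1 then p 0 else if Even i then e else p 1
  have hg : ∀ i, i + 1 < k → G.Adj (g i) (g (i + 1)) := by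
    intro i hi
    simp only [g, if_neg (show i ≠ k - 1 by omega), Nat.even_add_one]
    split_ifs <;> first | exact ae0.symm | exact h01.symm | exact ae1.symm | exact ae1
  obtain ⟨φ, hφp, hφ⟩ := exists_map_eq (p := p) (s := {i | 2 ≤ i ∧ i < k}) (by
    intro i hi j hj hij
    rcases lt_trichotomy i j with h1 | h1 | h1
    · exact absurd hij (hp.inj _ _ h1 hj.2)
    · exact h1
    · exact absurd hij.symm (hp.inj _ _ h1 hi.2)) g
  have hφE : ∀ x ∈ E, φ x = x := by
    intro x hx
    refine hφ x ?_
    rintro ⟨i, ⟨h1, h2⟩, rfl⟩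
    exact hpE i h1 h2 hx
  let S : Set V := {x | (x ∈ E ∧ x ≠ p 0) ∨ ∃ i, (2 ≤ i ∧ i < k) ∧ p i = x}
  have h1S : p 1 ∈ S := Or.inl ⟨h1E, h01.ne'⟩
  have hS : (G.induce S).Connected := by
    refine induce_connected_of_closed h1S fun T _ h1T hcl => ?_
    have hi : ∀ i, i + 1 < k → p (i + 1) ∈ T := by
      intro i
      induction i with
      | zero => exact fun _ => h1T
      | succ i ih =>
        intro hi
        exact hcl _ (ih (by omega)) _ (Or.inr ⟨i + 2, ⟨by omega, hi⟩, rfl⟩) (hsucc _ hi)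
    rintro x (⟨hx, hx0⟩ | ⟨i, ⟨h2, hik⟩, rfl⟩)
    · by_cases hx1 : x = p 1
      · exact hx1 ▸ h1T
      · exact hcl _ h1T x (Or.inl ⟨hx, hx0⟩) (hEn.isClique h1E hx (Ne.symm hx1))
    · have := hi (i - 1) (by omega)
      rwa [show i - 1 + 1 = i by omega] at this
  have hEp : ∀ x ∈ E, x ≠ p 0 → ∀ i, 2 ≤ i → i < k → G.Adj x (p i) → G.Adj (φ x) (φ (p i)) := by
    intro x hx hx0 i h2 hik hadj
    by_cases hx1 : x = p 1
    · subst hx1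
      have hi2 : i = 2 := by
        have := (hp.adj_iff 1 i (by omega) hik).1 hadj
        omega
      subst hi2
      rw [hφE _ h1E, hφp 2 ⟨h2, hik⟩]
      simp only [g, if_neg (show 2 ≠ k - 1 by omega), if_pos even_two]
      exact ae1
    · exact absurd hadj (hnadj x hx hx0 hx1 i h2 hik)
  have hφS : HomOn G S φ := by
    rintro a (⟨ha, ha0⟩ | ⟨i, ⟨h2, hik⟩, rfl⟩) b (⟨hb, hb0⟩ | ⟨j, ⟨h2', hjk⟩, rfl⟩) hab
    · rwa [hφE a ha, hφE b hb]
    · exact hEp a ha ha0 j h2' hjk hab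
    · exact (hEp b hb hb0 i h2 hik hab.symm).symm
    · rw [hφp i ⟨h2, hik⟩, hφp j ⟨h2', hjk⟩]
      rcases lt_trichotomy i j with h1 | rfl | h1
      · have := (hp.adj_iff i j h1 hjk).1 hab
        obtain rfl : j = i + 1 := by omega
        exact hg i hjk
      · exact absurd hab (G.loopless.irrefl _)
      · have := (hp.adj_iff j i h1 hik).1 hab.symm
        obtain rfl : i = j + 1 := by omega
        exact (hg j hik).symm
  obtain ⟨u, hu⟩ := h.exists_adj_map hS hφS (p 0)
  refine not_forall_adj_of_isNClique hmax hEn u fun x hx => ?_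
  by_cases hx0 : x = p 0
  · have := hu _ (Or.inr ⟨k - 1, ⟨by omega, by omega⟩, rfl⟩) hlast
    rw [hφp _ ⟨by omega, by omega⟩] at this
    simpa [g, hx0] using this
  · have := hu x (Or.inl ⟨hx, hx0⟩) (hEn.isClique h0E hx (Ne.symm hx0))
    rwa [hφE x hx] at this

theorem IsCHH.isTreelike (hG : G.Connected) (h : IsCHH G) {Q : Finset V} (hQ : G.IsNClique n Q)
    (hn : 3 ≤ n) (hmax : ∀ T : Finset V, G.IsClique T → T.card ≤ n) : IsTreelike n G := by
  classical
  have hsup : ∀ A : Finset V, G.IsClique A → A.Nonempty → ∃ E, A ⊆ E ∧ G.IsNClique n E :=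
    fun A hA hne => h.exists_isNClique_superset hQ hmax hA hne
  refine ⟨hG, {C | G.IsNClique n C}, fun C hC => hC, fun v => ?_, fun u v huv => ?_, ?_, ?_⟩
  · obtain ⟨E, hE, hEn⟩ := hsup {v} (by simp) ⟨v, by simp⟩
    exact ⟨E, hEn, hE (by simp)⟩
  · obtain ⟨E, hE, hEn⟩ := hsup {u, v} (by simp [isClique_insert, huv]) ⟨v, by simp⟩
    exact ⟨E, hEn, hE (by simp), hE (by simp)⟩
  · intro C hC D hD hne u v huC huD hvC hvD
    by_contra huv
    have hadj : G.Adj u v := hC.isClique huC hvC huv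
    refine hne (Finset.eq_of_subset_of_card_le (fun x hx => ?_) (by rw [hC.card_eq, hD.card_eq]))
    by_contra hxD
    have hxu : u ≠ x := fun h => hxD (h ▸ huD)
    have hxv : v ≠ x := fun h => hxD (h ▸ hvD)
    refine not_forall_adj_of_isNClique hmax hD x fun d hd => ?_
    by_cases hdu : u = d
    · exact hdu ▸ (hC.isClique huC hx hxu).symm
    by_cases hdv : v = d
    · exact hdv ▸ (hC.isClique hvC hx hxv).symm
    exact h.adj_of_adj_adj hQ hmax (hC.isClique huC hx hxu) hadj (hD.isClique huD hd hdu)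
      (hC.isClique hvC hx hxv).symm (hD.isClique hvD hd hdv) fun h => hxD (h ▸ hd)
  · intro k hk f
    obtain ⟨p, hp, hfp⟩ := exists_isInducedCycle hk f
    rcases hk.eq_or_lt with rfl | hk
    · have h01 := (hp.adj_iff 0 1 (by omega) (by omega)).2 (by omega)
      have h12 := (hp.adj_iff 1 2 (by omega) (by omega)).2 (by omega)
      have h02 := (hp.adj_iff 0 2 (by omega) (by omega)).2 (by omega)
      obtain ⟨E, hE, hEn⟩ := hsup {p 0, p 1, p 2} (by
        simp [isClique_insert, h01, h12, h02]) ⟨p 0, by simp⟩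
      refine ⟨E, hEn, fun i => hE ?_⟩
      rw [hfp]
      fin_cases i <;> simp
    · exact absurd hp (h.not_isInducedCycle hQ hn hmax k hk p)

end Triangle

/-! ### Necessity without triangles: bipartiteness and common neighbours -/

/-- In the two-squares graph, remove one end of the diagonal. An induced cycle other than a square
is even by the colouring, hence has length at least 6; remove any vertex. -/
theorem exists_isInducedPath_of_not {c : V → Prop} (hc : ∀ a b, G.Adj a b → (c a ↔ ¬ c b))
    (h : ¬ (AllInducedCyclesSquares G ∧ ¬ twoSquares.IsIndContained G)) :
    ∃ p m v, IsInducedPath G p m ∧ Even m ∧ 4 ≤ m ∧ G.Adj v (p 0) ∧ G.Adj v (p m) := by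
  by_cases h1 : AllInducedCyclesSquares G
  · obtain ⟨f⟩ : twoSquares.IsIndContained G := by
      by_contra h2
      exact h ⟨h1, h2⟩
    refine ⟨fun i => f (Fin.ofNat 6 i), 4, f 5, ⟨fun i j hij hj h => ?_, fun i j hij hj => ?_⟩,
      by decide, le_rfl, f.map_adj_iff.2 (by decide), f.map_adj_iff.2 (by decide)⟩
    · have := f.injective h
      interval_cases j <;> interval_cases i <;> revert this <;> decide
    · rw [f.map_adj_iff]
      interval_cases j <;> interval_cases i <;> decide
  · simp only [AllInducedCyclesSquares, not_forall] at h1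
    obtain ⟨k, hk, ⟨f⟩, hk4⟩ := h1
    obtain ⟨p, hp, -⟩ := exists_isInducedCycle hk f
    have hcol : ∀ i, i < k → (c (p i) ↔ (c (p 0) ↔ Even i)) := by
      intro i
      induction i with
      | zero => simp
      | succ i ih =>
        intro hi
        have h1 := hc _ _ ((hp.adj_iff i (i + 1) (by omega) hi).2 (Or.inl rfl))
        have h2 := ih (by omega)
        rw [Nat.even_add_one]
        tauto
    have hlast := (hp.adj_iff 0 (k - 1) (by omega) (by omega)).2 (Or.inr ⟨rfl, by omega⟩)
    have hprev := (hp.adj_iff (k - 2) (k - 1) (by omega) (by omega)).2 (by omega)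
    have hodd : ¬ Even (k - 1) := by
      have h1 := hc _ _ hlast
      have h2 := hcol (k - 1) (by omega)
      tauto
    have heven : Even (k - 2) := by
      have := Nat.even_add_one (n := k - 2)
      rw [show k - 2 + 1 = k - 1 by omega] at this
      tauto
    refine ⟨p, k - 2, p (k - 1), ⟨fun i j hij hj => hp.inj i j hij (by omega), fun i j hij hj => ?_⟩,
      heven, ?_, hlast.symm, hprev.symm⟩
    · rw [hp.adj_iff i j hij (by omega)]
      omega
    · obtain ⟨l, hl⟩ := heven
      omega

theorem color_iff_of_matching {n : ℕ} {x y : Fin n → V} {c : V → Prop} (hn : 3 ≤ n) (hxy : ∀ i j, G.Adj (x i) (y j) ↔ i ≠ j)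
    (hc : ∀ a b, G.Adj a b → (c a ↔ ¬ c b)) (i j : Fin n) :
    (c (x i) ↔ c (x j)) ∧ (c (x i) ↔ ¬ c (y j)) := by
  have h1 : ∀ i j, c (x i) ↔ c (x j) := by
    intro i j
    obtain ⟨k, hki, hkj⟩ := Fin.exists_ne_and_ne_of_two_lt i j hn
    have h1 := hc _ _ ((hxy i k).2 hki.symm)
    have h2 := hc _ _ ((hxy j k).2 hkj.symm)
    tauto
  refine ⟨h1 i j, ?_⟩
  obtain ⟨k, hkj, -⟩ := Fin.exists_ne_and_ne_of_two_lt j j hn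
  have h2 := hc _ _ ((hxy k j).2 hkj)
  have h3 := h1 i k
  tauto

variable [Finite V]

/-- Colour by parity of the distance from a root. If this fails, take an edge `u w` inside the
lowest possible layer `d`. Parity maps the ball below `d`, together with `u`, onto that edge; `w`
sees both parities there, so its image forms a triangle with `u` and `w`. -/
theorem IsCHH.exists_coloring (hG : G.Connected) (h : IsCHH G)
    (hT : ∀ a b c, G.Adj a b → G.Adj b c → ¬ G.Adj a c) :
    ∃ c : V → Prop, ∀ a b, G.Adj a b → (c a ↔ ¬ c b) := by
  classical
  obtain ⟨r⟩ := hG.nonempty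
  have hdist : ∀ {a b}, G.Adj a b → G.dist r a ≤ G.dist r b + 1 ∧ G.dist r b ≤ G.dist r a + 1 := by
    intro a b hab
    have h1 := dist_eq_one_iff_adj.2 hab
    have h2 := hG.dist_triangle (u := r) (v := a) (w := b)
    have h3 := hG.dist_triangle (u := r) (v := b) (w := a)
    rw [dist_comm (u := b)] at h3
    omega
  by_cases hex : ∃ d u w, G.Adj u w ∧ G.dist r u = d ∧ G.dist r w = d
  swap
  · refine ⟨fun x => Even (G.dist r x), fun a b hab => ?_⟩
    have h1 := hdist hab
    have h2 : G.dist r a ≠ G.dist r b := fun h => hex ⟨_, a, b, hab, rfl, h.symm⟩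
    rcases (show G.dist r a = G.dist r b + 1 ∨ G.dist r b = G.dist r a + 1 by omega) with h3 | h3
    · simp only [h3, Nat.even_add_one]
    · simp only [h3, Nat.even_add_one, not_not]
  exfalso
  obtain ⟨u, w, huw, hu, hw⟩ := Nat.find_spec hex
  have hmin : ∀ a b, G.Adj a b → G.dist r a < Nat.find hex → G.dist r a ≠ G.dist r b :=
    fun a b hab hlt heq => Nat.find_min hex hlt ⟨a, b, hab, rfl, heq.symm⟩
  generalize Nat.find hex = d at *
  have hd : 0 < d := by
    by_contra hd0
    have h1 := hG.dist_eq_zero_iff.1 (show G.dist r u = 0 by omega)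
    have h2 := hG.dist_eq_zero_iff.1 (show G.dist r w = 0 by omega)
    exact huw.ne (h1.symm.trans h2)
  have hparent : ∀ x, 0 < G.dist r x → ∃ y, G.Adj x y ∧ G.dist r y + 1 = G.dist r x := by
    intro x hx
    obtain ⟨p, hp⟩ := hG.exists_walk_length_eq_dist r x
    have h1 := p.adj_getVert_succ (i := p.length - 1) (by omega)
    rw [show p.length - 1 + 1 = p.length by omega, p.getVert_length] at h1
    have h2 := dist_le (p.take (p.length - 1))
    rw [Walk.take_length] at h2
    have := hdist h1
    exact ⟨_, h1.symm, by omega⟩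
  have hball : (G.induce {x | G.dist r x < d}).Connected := by
    refine induce_connected_of_closed (r := r) (by simpa using hd) fun T _ hrT hcl => ?_
    have : ∀ m < d, ∀ x, G.dist r x = m → x ∈ T := by
      intro m
      induction m with
      | zero => exact fun _ x hx => hG.dist_eq_zero_iff.1 hx ▸ hrT
      | succ m ih =>
        intro hm x hx
        obtain ⟨y, hxy, hy⟩ := hparent x (by omega)
        exact hcl y (ih (by omega) y (by omega)) x (show G.dist r x < d by omega) hxy.symm
    exact fun x hx => this _ hx x rfl
  obtain ⟨u', huu', hu'⟩ := hparent u (by omega)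
  obtain ⟨w', hww', hw'⟩ := hparent w (by omega)
  have hS := induce_insert_connected hball (show G.dist r u' < d by omega) huu'
  have hφ : HomOn G (insert u {x | G.dist r x < d}) fun x =>
      if Even (G.dist r x) then u else w := by
    intro a ha b hb hab
    have h1 := hdist hab
    have h2 : G.dist r a ≠ G.dist r b := by
      rcases ha with rfl | ha
      · rcases hb with rfl | hb
        · exact absurd hab (G.loopless.irrefl _)
        · have : G.dist r b < d := hb
          omega
      · exact hmin a b hab ha
    rcases (show G.dist r a = G.dist r b + 1 ∨ G.dist r b = G.dist r a + 1 by omega) with h3 | h3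
    · by_cases h4 : Even (G.dist r b)
      · simpa [h3, Nat.even_add_one, h4] using huw.symm
      · simpa [h3, Nat.even_add_one, h4] using huw
    · by_cases h4 : Even (G.dist r a)
      · simpa [h3, Nat.even_add_one, h4] using huw
      · simpa [h3, Nat.even_add_one, h4] using huw.symm
  obtain ⟨z, hz⟩ := h.exists_adj_map hS hφ w
  have h1 := hz u (Or.inl rfl) huw.symm
  have h2 := hz w' (Or.inr (show G.dist r w' < d by omega)) hww'
  obtain rfl : G.dist r w' + 1 = d := by omega
  rw [hu] at h1
  by_cases h4 : Even (G.dist r w')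
  · simp only [Nat.even_add_one, h4, not_true, if_true, if_false] at h1 h2
    exact hT _ _ _ h2 huw h1
  · simp only [Nat.even_add_one, h4, not_false_iff, if_true, if_false] at h1 h2
    exact hT _ _ _ h1 huw h2

/-- Wrap the induced path around the walk `a, b, c, d, e`, then bounce between `d` and `e`. As `m`
is even, `p m` lands on `e`, and the image of `v` is the common neighbour. -/
theorem IsCHH.exists_adj_adj_of_walk (h : IsCHH G) {p : ℕ → V} {m : ℕ} (hp : IsInducedPath G p m)
    (hm : Even m) (hm4 : 4 ≤ m) {v : V} (hv0 : G.Adj v (p 0)) (hvm : G.Adj v (p m))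
    {a b c d e : V} (hab : G.Adj a b) (hbc : G.Adj b c) (hcd : G.Adj c d) (hde : G.Adj d e) :
    ∃ u, G.Adj u a ∧ G.Adj u e := by
  let g : ℕ → V := fun i => if i = 0 then a else if i = 1 then b else if i = 2 then c else
    if Even i then e else d
  have hg : ∀ i, G.Adj (g i) (g (i + 1)) := by
    intro i
    rcases (show i = 0 ∨ i = 1 ∨ i = 2 ∨ 3 ≤ i by omega) with rfl | rfl | rfl | hi
    · exact hab
    · exact hbc
    · simpa [g, show ¬ Even 3 by decide] using hcd
    · simp only [g, show i ≠ 0 by omega, show i ≠ 1 by omega, show i ≠ 2 by omega,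
        show i + 1 ≠ 0 by omega, show i + 1 ≠ 1 by omega, show i + 1 ≠ 2 by omega, if_false,
        Nat.even_add_one]
      split_ifs
      · exact hde.symm
      · exact hde
  obtain ⟨φ, hφ, -⟩ := exists_map_eq (p := p) (s := {i | i ≤ m}) (by
    intro i hi j hj hij
    rcases lt_trichotomy i j with h1 | h1 | h1
    · exact absurd hij (hp.inj _ _ h1 hj)
    · exact h1
    · exact absurd hij.symm (hp.inj _ _ h1 hi)) g
  obtain ⟨u, hu⟩ := h.exists_adj_map (induce_path_connected p m fun i hi =>
    (hp.adj_iff i (i + 1) (by omega) (by omega)).2 rfl) (φ := φ) (by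
      rintro _ ⟨i, hi, rfl⟩ _ ⟨j, hj, rfl⟩ hij
      rw [hφ i hi, hφ j hj]
      rcases lt_trichotomy i j with h1 | rfl | h1
      · rw [hp.adj_iff i j h1 hj] at hij
        exact hij ▸ hg i
      · exact absurd hij (G.loopless.irrefl _)
      · have hij := hij.symm
        rw [hp.adj_iff j i h1 hi] at hij
        exact hij ▸ (hg j).symm) v
  have h0 := hu (p 0) ⟨0, Nat.zero_le _, rfl⟩ hv0
  have h1 := hu (p m) ⟨m, le_refl m, rfl⟩ hvm
  rw [hφ 0 (Nat.zero_le _)] at h0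
  rw [hφ m (le_refl m)] at h1
  refine ⟨u, h0, ?_⟩
  simpa [g, hm, show m ≠ 0 by omega, show m ≠ 1 by omega, show m ≠ 2 by omega] using h1

theorem IsCHH.exists_adj_adj_of_color_eq [Nontrivial V] (hG : G.Connected) (h : IsCHH G)
    {c : V → Prop}
    (hc : ∀ a b, G.Adj a b → (c a ↔ ¬ c b))
    (hns : ¬ (AllInducedCyclesSquares G ∧ ¬ twoSquares.IsIndContained G)) {a b : V}
    (hab : c a ↔ c b) : ∃ u, G.Adj u a ∧ G.Adj u b := by
  obtain ⟨p, m, v, hp, hm, hm4, hv0, hvm⟩ := exists_isInducedPath_of_not hc hns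
  -- Walks of length 4 shorten to length 2, so every vertex is reached from `a` by a walk of length
  -- 2 or 3; the colouring rules out 3.
  have key : (∃ u, G.Adj u a ∧ G.Adj u b) ∨ ∃ x, G.Adj x b ∧ ∃ u, G.Adj u a ∧ G.Adj u x := by
    refine connected_induction hG (P := fun b => (∃ u, G.Adj u a ∧ G.Adj u b) ∨
      ∃ x, G.Adj x b ∧ ∃ u, G.Adj u a ∧ G.Adj u x) (a := a) ?_ ?_ b
    · obtain ⟨b, hb⟩ := exists_ne a
      obtain ⟨u, hu⟩ := exists_adj_of_connected hG hb.symm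
      exact Or.inl ⟨u, hu.symm, hu.symm⟩
    · rintro x y hxy (⟨u, hua, hux⟩ | ⟨z, hzx, u, hua, huz⟩)
      · exact Or.inr ⟨x, hxy, u, hua, hux⟩
      · exact Or.inl (h.exists_adj_adj_of_walk hp hm hm4 hv0 hvm hua.symm huz hzx hxy)
  rcases key with h1 | ⟨x, hxb, u, hua, hux⟩
  · exact h1
  · have h1 := hc _ _ hxb
    have h2 := hc _ _ hua
    have h3 := hc _ _ hux
    tauto

theorem IsCHH.exists_adj_of_independent (h : IsCHH G) {P Q : Set V}
    (hP : ∀ a ∈ P, ∀ b ∈ P, ¬ G.Adj a b) (hQ : ∀ a ∈ Q, ∀ b ∈ Q, ¬ G.Adj a b)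
    (hPQ : (G.induce (P ∪ Q)).Connected) (f : V → V)
    (hf : ∀ q ∈ Q, ∃ u, ∀ p ∈ P, G.Adj q p → G.Adj u (f p)) (v : V) :
    ∃ u, ∀ p ∈ P, G.Adj v p → G.Adj u (f p) := by
  classical
  have hf' : ∀ q, ∃ u, q ∈ Q → ∀ p ∈ P, G.Adj q p → G.Adj u (f p) := fun q => by
    by_cases hq : q ∈ Q
    · exact (hf q hq).imp fun u hu _ => hu
    · exact ⟨q, fun h => absurd h hq⟩
  choose g hg using hf'
  obtain ⟨u, hu⟩ := h.exists_adj_map hPQ (φ := fun x => if x ∈ P then f x else g x) (by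
    intro a ha b hb hab
    by_cases haP : a ∈ P
    · have hbP : b ∉ P := fun hbP => hP a haP b hbP hab
      simpa [haP, hbP] using (hg b (hb.resolve_left hbP) a haP hab.symm).symm
    · have haQ := ha.resolve_left haP
      have hbP : b ∈ P := hb.resolve_right fun hbQ => hQ a haQ b hbQ hab
      simpa [haP, hbP] using hg a haQ b hbP hab) v
  exact ⟨u, fun p hp hvp => by simpa [hp] using hu p (Or.inl hp) hvp⟩

/-! ### Configurations complementary to a perfect matching -/

section Matching

variable {n : ℕ} {x y : Fin n → V} {c : V → Prop}

/-- Exchanging each `x i` with `y i` is a homomorphism; it would carry a common neighbour of the `y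
i` to one of the `x i`. -/
theorem IsCHH.not_forall_adj_of_matching (h : IsCHH G) (hn : 3 ≤ n)
    (hxy : ∀ i j, G.Adj (x i) (y j) ↔ i ≠ j) (hc : ∀ a b, G.Adj a b → (c a ↔ ¬ c b))
    (hyinj : Function.Injective y) (hx : ∀ u, ∃ i, ¬ G.Adj u (x i)) (u : V) :
    ∃ i, ¬ G.Adj u (y i) := by
  by_contra! hu
  have hcol := color_iff_of_matching hn hxy hc
  have hconn : (G.induce (Set.range y ∪ Set.range x)).Connected := by
    let i0 : Fin n := ⟨0, by omega⟩
    refine induce_connected_of_closed (r := y i0) (Or.inl ⟨_, rfl⟩) fun T _ hT hcl => ?_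
    have hxT : ∀ i, i ≠ i0 → x i ∈ T := fun i hi =>
      hcl _ hT _ (Or.inr ⟨i, rfl⟩) ((hxy _ _).2 hi).symm
    have hyT : ∀ i, y i ∈ T := fun i => by
      obtain ⟨k, hk0, hki⟩ := Fin.exists_ne_and_ne_of_two_lt i0 i hn
      exact hcl _ (hxT k hk0) _ (Or.inl ⟨i, rfl⟩) ((hxy _ _).2 hki)
    rintro _ (⟨i, rfl⟩ | ⟨i, rfl⟩)
    · exact hyT i
    · obtain ⟨k, hki, -⟩ := Fin.exists_ne_and_ne_of_two_lt i i hn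
      exact hcl _ (hyT k) _ (Or.inr ⟨i, rfl⟩) ((hxy _ _).2 hki.symm).symm
  obtain ⟨z, hz⟩ := h.exists_adj_of_independent (P := Set.range y) (Q := Set.range x)
    (by
      rintro _ ⟨i, rfl⟩ _ ⟨j, rfl⟩ hij
      have := hc _ _ hij
      have := (hcol i i).2
      have := (hcol i j).2
      tauto)
    (by
      rintro _ ⟨i, rfl⟩ _ ⟨j, rfl⟩ hij
      have := hc _ _ hij
      have := (hcol i j).1
      tauto)
    hconn (Function.extend y x id) (by
      rintro _ ⟨i, rfl⟩
      refine ⟨y i, ?_⟩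
      rintro _ ⟨j, rfl⟩ hij
      rw [hyinj.extend_apply]
      exact ((hxy j i).2 ((hxy i j).1 hij).symm).symm) u
  obtain ⟨i, hi⟩ := hx z
  have := hz _ ⟨i, rfl⟩ (hu i)
  rw [hyinj.extend_apply] at this
  exact hi this

theorem IsCHH.mem_range_of_adj (h : IsCHH G) (hn : 3 ≤ n)
    (hxy : ∀ i j, G.Adj (x i) (y j) ↔ i ≠ j) (hc : ∀ a b, G.Adj a b → (c a ↔ ¬ c b))
    (hpair : ∀ a b, (c a ↔ c b) → ∃ u, G.Adj u a ∧ G.Adj u b)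
    (hxinj : Function.Injective x) (hx : ∀ u, ∃ i, ¬ G.Adj u (x i))
    (hy : ∀ u, ∃ i, ¬ G.Adj u (y i)) {w : V} {i₀ : Fin n} (hw : G.Adj w (y i₀)) :
    w ∈ Set.range x := by
  classical
  by_contra hwx
  have hcol := color_iff_of_matching hn hxy hc
  have hcw : ∀ i, c w ↔ c (x i) := fun i => by
    have := hc _ _ hw
    have := (hcol i i₀).2
    tauto
  -- The vertex `z` ties `w` to the configuration without using `y i₀`. If `w` has another neighbour
  -- `y k`, take `z = y k`; otherwise `hpair` provides `z`, and `i₁` is any third index.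
  obtain ⟨i₁, z, hi₁, hwi₁, hzw, hz₀, j₀, hj₀, hj₁, hzj⟩ : ∃ i₁ z, i₁ ≠ i₀ ∧ ¬ G.Adj w (y i₁) ∧
      G.Adj z w ∧ G.Adj z (x i₀) ∧ ∃ j₀, j₀ ≠ i₀ ∧ j₀ ≠ i₁ ∧ ¬ G.Adj z (x j₀) := by
    by_cases hk : ∃ k, k ≠ i₀ ∧ G.Adj w (y k)
    · obtain ⟨k, hk, hwk⟩ := hk
      obtain ⟨i₁, hi₁⟩ := hy w
      exact ⟨i₁, y k, fun h => hi₁ (h ▸ hw), hi₁, hwk.symm, ((hxy _ _).2 hk.symm).symm, k, hk,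
        fun h => hi₁ (h ▸ hwk), fun h => (hxy k k).1 h.symm rfl⟩
    · push Not at hk
      obtain ⟨z, hzw, hz₀⟩ := hpair w (x i₀) (hcw i₀)
      obtain ⟨j₀, hj₀⟩ := hx z
      obtain ⟨i₁, hi₁, hij⟩ := Fin.exists_ne_and_ne_of_two_lt i₀ j₀ hn
      exact ⟨i₁, z, hi₁, hk i₁ hi₁, hzw, hz₀, j₀, fun h => hj₀ (h ▸ hz₀), hij.symm, hj₀⟩
  let P : Set V := insert w (Set.range x)
  let Q : Set V := insert z (y '' {j | j ≠ i₀})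
  have hcP : ∀ p ∈ P, (c p ↔ c w) := by
    rintro p (rfl | ⟨i, rfl⟩)
    · rfl
    · exact (hcw i).symm
  have hcQ : ∀ q ∈ Q, (c q ↔ ¬ c w) := by
    rintro q (rfl | ⟨i, -, rfl⟩)
    · exact hc _ _ hzw
    · have := (hcol i i).2
      have := hcw i
      tauto
  -- The shift `w ↦ x i₀ ↦ x i₁` turns `N(y i₀) ∩ P`, which is `w` and the `x i` with `i ≠ i₀`, into
  -- the set of all `x i`. It extends to `Q` by `z ↦ y j₀`, `y i₁ ↦ y i₀` (allowed as `y i₁` misses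
  -- `w`), and fixing the remaining `y j`.
  let f : V → V := fun p => if p = w then x i₀ else if p = x i₀ then x i₁ else p
  have hxw : ∀ i, x i ≠ w := fun i hi => hwx ⟨i, hi⟩
  have hfw : f w = x i₀ := if_pos rfl
  have hf₀ : f (x i₀) = x i₁ := by simp [f, hxw]
  have hf : ∀ i, i ≠ i₀ → f (x i) = x i := fun i hi => by simp [f, hxw, hxinj.eq_iff, hi]
  have hconn : (G.induce (P ∪ Q)).Connected := by
    refine induce_connected_of_closed (r := x i₀) (Or.inl (Or.inr ⟨_, rfl⟩))
      fun T _ hT hcl => ?_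
    have hyT : ∀ j, j ≠ i₀ → y j ∈ T := fun j hj =>
      hcl _ hT _ (Or.inr (Or.inr ⟨j, hj, rfl⟩)) ((hxy _ _).2 hj.symm)
    have hzT : z ∈ T := hcl _ hT _ (Or.inr (Or.inl rfl)) hz₀.symm
    rintro v ((rfl | ⟨i, rfl⟩) | (rfl | ⟨j, hj, rfl⟩))
    · exact hcl _ hzT _ (Or.inl (Or.inl rfl)) hzw
    · obtain ⟨k, hk₀, hki⟩ := Fin.exists_ne_and_ne_of_two_lt i₀ i hn
      exact hcl _ (hyT k hk₀) _ (Or.inl (Or.inr ⟨i, rfl⟩)) ((hxy _ _).2 hki.symm).symm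
    · exact hzT
    · exact hyT j hj
  have hyx : ∀ {i j}, i ≠ j → G.Adj (y i) (x j) := fun hij => ((hxy _ _).2 hij.symm).symm
  obtain ⟨u, hu⟩ := h.exists_adj_of_independent (P := P) (Q := Q)
    (fun a ha b hb hab => by
      have := hc _ _ hab
      have := hcP a ha
      have := hcP b hb
      tauto)
    (fun a ha b hb hab => by
      have := hc _ _ hab
      have := hcQ a ha
      have := hcQ b hb
      tauto)
    hconn f (by
      rintro q (rfl | ⟨j, hj, rfl⟩)
      · refine ⟨y j₀, ?_⟩
        rintro p (rfl | ⟨l, rfl⟩) hqp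
        · exact hfw ▸ hyx hj₀
        · by_cases hl : l = i₀
          · subst hl
            exact hf₀ ▸ hyx hj₁
          · rw [hf l hl]
            exact hyx fun h => hzj (h ▸ hqp)
      · by_cases hji : j = i₁
        · subst hji
          refine ⟨y i₀, ?_⟩
          rintro p (rfl | ⟨l, rfl⟩) hqp
          · exact absurd hqp.symm hwi₁
          · by_cases hl : l = i₀
            · subst hl
              exact hf₀ ▸ hyx hj.symm
            · rw [hf l hl]
              exact hyx (Ne.symm hl)
        · refine ⟨y j, ?_⟩
          rintro p (rfl | ⟨l, rfl⟩) hqp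
          · exact hfw ▸ hyx hj
          · by_cases hl : l = i₀
            · subst hl
              exact hf₀ ▸ hyx hji
            · rwa [hf l hl]) (y i₀)
  obtain ⟨i, hi⟩ := hx u
  by_cases hii : i = i₀
  · have := hu w (Or.inl rfl) hw.symm
    rw [hfw] at this
    exact hi (hii ▸ this)
  · have := hu (x i) (Or.inr ⟨i, rfl⟩) (hyx (Ne.symm hii))
    rw [hf i hii] at this
    exact hi this

theorem IsCHH.nonempty_iso_of_matching (hG : G.Connected) (h : IsCHH G) (hn : 3 ≤ n)
    (hxy : ∀ i j, G.Adj (x i) (y j) ↔ i ≠ j) (hc : ∀ a b, G.Adj a b → (c a ↔ ¬ c b))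
    (hpair : ∀ a b, (c a ↔ c b) → ∃ u, G.Adj u a ∧ G.Adj u b)
    (hxinj : Function.Injective x) (hx : ∀ u, ∃ i, ¬ G.Adj u (x i)) :
    Nonempty (G ≃g bipartiteComplementMatching n) := by
  have hyinj : Function.Injective y := fun i j hij => by
    by_contra hne
    have := (hxy j i).2 (Ne.symm hne)
    rw [hij] at this
    exact (hxy j j).1 this rfl
  have hyx : ∀ i j, G.Adj (y i) (x j) ↔ i ≠ j := fun i j => by
    rw [adj_comm, hxy, ne_comm]
  have hy := h.not_forall_adj_of_matching hn hxy hc hyinj hx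
  have hcol := color_iff_of_matching hn hxy hc
  have hsurj : ∀ v, v ∈ Set.range x ∨ v ∈ Set.range y := by
    refine connected_induction hG (P := fun v => v ∈ Set.range x ∨ v ∈ Set.range y)
      (a := x ⟨0, by omega⟩) (Or.inl ⟨_, rfl⟩) ?_
    rintro _ w hvw (⟨i, rfl⟩ | ⟨i, rfl⟩)
    · exact Or.inr (h.mem_range_of_adj hn hyx hc hpair hyinj hy hx hvw.symm)
    · exact Or.inl (h.mem_range_of_adj hn hxy hc hpair hxinj hx hy hvw.symm)
  have hne : ∀ i j, x i ≠ y j := fun i j hij => by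
    have := (hcol i j).2
    rw [hij] at this
    tauto
  refine ⟨RelIso.symm ⟨Equiv.ofBijective (Sum.elim x y) ⟨hxinj.sumElim hyinj hne, ?_⟩, ?_⟩⟩
  · intro v
    rcases hsurj v with ⟨i, rfl⟩ | ⟨i, rfl⟩
    · exact ⟨Sum.inl i, rfl⟩
    · exact ⟨Sum.inr i, rfl⟩
  · intro a b
    change G.Adj (Sum.elim x y a) (Sum.elim x y b) ↔ _
    rw [bipartiteComplementMatching_adj]
    rcases a with i | i <;> rcases b with j | j <;>
      simp only [Sum.elim_inl, Sum.elim_inr, idx, id, Sum.isLeft_inl,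
        Sum.isLeft_inr, hxy, hyx, ne_eq, not_true, false_and, iff_false, reduceCtorEq,
        not_false_iff, true_and]
    · intro hij
      have := hc _ _ hij
      have := (hcol i j).1
      tauto
    · intro hij
      have := hc _ _ hij
      have := (hcol i i).2
      have := (hcol i j).2
      tauto

end Matching

/-! ### The minimal set without common neighbour and the classification -/

theorem IsCHH.exists_iso_of_not_commonNeighbours [Nontrivial V] (hG : G.Connected) (h : IsCHH G)
    {c : V → Prop} (hc : ∀ a b, G.Adj a b → (c a ↔ ¬ c b))
    (hpair : ∀ a b, (c a ↔ c b) → ∃ u, G.Adj u a ∧ G.Adj u b)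
    (hnc : ¬ IsBipartiteWithCommonNeighbours G) :
    ∃ n, 3 ≤ n ∧ Nonempty (G ≃g bipartiteComplementMatching n) := by
  classical
  have := Fintype.ofFinite V
  let p : Finset V → Prop := fun A => (∃ l : Prop, ∀ a ∈ A, (c a ↔ l)) ∧ ∀ u, ∃ a ∈ A, ¬ G.Adj u a
  obtain ⟨A, hA⟩ : ∃ A, p A := by
    by_contra! hno
    have hl : ∀ l : Prop, ∃ u, ∀ a, (c a ↔ l) → G.Adj u a := by
      intro l
      by_contra! hl
      refine hno (Finset.univ.filter fun a => c a ↔ l) ⟨⟨l, fun a ha => (by simpa using ha)⟩,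
        fun u => ?_⟩
      obtain ⟨a, ha, hua⟩ := hl u
      exact ⟨a, by simpa using ha, hua⟩
    obtain ⟨u, hu⟩ := hl True
    obtain ⟨w, hw⟩ := hl False
    refine hnc ⟨{a | c a}, {a | ¬ c a}, ⟨?_, ?_⟩, ?_, ⟨u, fun a ha => hu a ?_⟩,
      ⟨w, fun a ha => hw a ?_⟩⟩
    · exact Set.disjoint_left.2 fun a ha hb => hb ha
    · intro a b hab
      have := hc a b hab
      by_cases ha : c a
      · exact Or.inl ⟨ha, this.1 ha⟩
      · exact Or.inr ⟨ha, by_contra fun hb => ha (this.2 hb)⟩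
    · exact Set.eq_univ_of_forall fun a => em (c a)
    · exact iff_true_intro ha
    · exact iff_false_intro ha
  -- Minimality gives, for each element of `A`, a vertex adjacent to all the others; these are the
  -- `y i`. Pairs of one colour have common neighbours, so `A` has at least three elements.
  obtain ⟨A, -, hA⟩ := Finite.exists_le_minimal hA
  obtain ⟨⟨l, hl⟩, hAu⟩ := hA.prop
  have hcard : 3 ≤ A.card := by
    by_contra hlt
    obtain ⟨a, b, ha, hab⟩ : ∃ a b, (c a ↔ c b) ∧ A ⊆ {a, b} := by
      rcases (show A.card = 0 ∨ A.card = 1 ∨ A.card = 2 by omega) with h0 | h1 | h2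
      · obtain ⟨r⟩ := hG.nonempty
        exact ⟨r, r, Iff.rfl, by simp [Finset.card_eq_zero.1 h0]⟩
      · obtain ⟨a, rfl⟩ := Finset.card_eq_one.1 h1
        exact ⟨a, a, Iff.rfl, by simp⟩
      · obtain ⟨a, b, -, rfl⟩ := Finset.card_eq_two.1 h2
        exact ⟨a, b, (hl a (by simp)).trans (hl b (by simp)).symm, Finset.Subset.refl _⟩
    obtain ⟨u, hua, hub⟩ := hpair a b ha
    obtain ⟨z, hz, huz⟩ := hAu u
    have := hab hz
    simp only [Finset.mem_insert, Finset.mem_singleton] at this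
    rcases this with rfl | rfl
    · exact huz hua
    · exact huz hub
  let e := A.equivFin
  let x : Fin A.card → V := fun i => e.symm i
  have hxinj : Function.Injective x := Subtype.val_injective.comp e.symm.injective
  have hxA : ∀ i, x i ∈ A := fun i => (e.symm i).2
  have hxs : ∀ a ∈ A, ∃ i, x i = a := fun a ha => ⟨e ⟨a, ha⟩, by simp [x]⟩
  have hx : ∀ u, ∃ i, ¬ G.Adj u (x i) := fun u => by
    obtain ⟨a, ha, hua⟩ := hAu u
    obtain ⟨i, rfl⟩ := hxs a ha
    exact ⟨i, hua⟩
  have hy : ∀ i, ∃ u, ∀ j, j ≠ i → G.Adj u (x j) := by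
    intro i
    by_contra! hno
    have : p (A.erase (x i)) := ⟨⟨l, fun a ha => hl a (Finset.mem_of_mem_erase ha)⟩, fun u => by
      obtain ⟨j, hj, huj⟩ := hno u
      exact ⟨x j, Finset.mem_erase.2 ⟨hxinj.ne hj, hxA j⟩, huj⟩⟩
    exact Finset.notMem_erase (x i) A (hA.le_of_le this (Finset.erase_subset _ _) (hxA i))
  choose y hy using hy
  refine ⟨A.card, hcard, h.nonempty_iso_of_matching (x := x) (y := y) hG hcard (fun i j => ?_) hc
    hpair hxinj hx⟩
  refine ⟨?_, fun hij => (hy j i hij).symm⟩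
  rintro hij rfl
  obtain ⟨k, hk⟩ := hx (y i)
  by_cases hki : k = i
  · exact hk (hki ▸ hij.symm)
  · exact hk (hy i k hki)

end CHomHom

theorem mainTheorem1 {V : Type*} [Finite V] (G : SimpleGraph V) (hG : G.Connected) :
    CHomHom.IsCHH G ↔
      (Nonempty (G ≃g (⊤ : SimpleGraph (Fin 1))) ∨
        (∃ n : ℕ, 2 ≤ n ∧ CHomHom.IsTreelike n G) ∨
        (CHomHom.AllInducedCyclesSquares G ∧ ¬ CHomHom.twoSquares.IsIndContained G) ∨
        CHomHom.IsBipartiteWithCommonNeighbours G ∨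
        (∃ n : ℕ, 3 ≤ n ∧ Nonempty (G ≃g CHomHom.bipartiteComplementMatching n))) := by
  constructor
  · intro h
    rcases subsingleton_or_nontrivial V with hV | hV
    · obtain ⟨r⟩ := hG.nonempty
      have : Unique V := ⟨⟨r⟩, fun _ => Subsingleton.elim _ _⟩
      refine Or.inl ⟨⟨Equiv.ofUnique V (Fin 1), ?_⟩⟩
      intro a b
      simp [Subsingleton.elim a b]
    obtain ⟨Q, hQ⟩ := G.exists_isNClique_cliqueNum
    have hmax : ∀ T : Finset V, G.IsClique T → T.card ≤ G.cliqueNum :=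
      fun T hT => SimpleGraph.IsClique.card_le_cliqueNum (tc := hT)
    -- Treelike graphs with `n = 2` are trees, which this direction places under (iii); so (ii) is
    -- only needed when a triangle exists.
    by_cases hn : 3 ≤ G.cliqueNum
    · exact Or.inr (Or.inl ⟨_, by omega, h.isTreelike hG hQ hn hmax⟩)
    have hT : ∀ a b c, G.Adj a b → G.Adj b c → ¬ G.Adj a c := by
      classical
      intro a b c hab hbc hac
      have := hmax {a, b, c} (by simp [SimpleGraph.isClique_insert, hab, hbc, hac])
      rw [Finset.card_eq_three.2 ⟨a, b, c, hab.ne, hac.ne, hbc.ne, rfl⟩] at this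
      exact hn this
    obtain ⟨c, hc⟩ := h.exists_coloring hG hT
    by_cases hsq : CHomHom.AllInducedCyclesSquares G ∧ ¬ CHomHom.twoSquares.IsIndContained G
    · exact Or.inr (Or.inr (Or.inl hsq))
    by_cases hcn : CHomHom.IsBipartiteWithCommonNeighbours G
    · exact Or.inr (Or.inr (Or.inr (Or.inl hcn)))
    exact Or.inr (Or.inr (Or.inr (Or.inr (h.exists_iso_of_not_commonNeighbours hG hc
      (fun a b hab => h.exists_adj_adj_of_color_eq hG hc hsq hab) hcn))))
  · rintro (⟨⟨e⟩⟩ | ⟨n, -, h⟩ | ⟨h, h2⟩ | h | ⟨n, -, ⟨e⟩⟩)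
    · have : Subsingleton V := e.toEquiv.subsingleton
      refine CHomHom.isCHH_of_exists_adj_map hG fun S hS φ _ v hv => ?_
      obtain ⟨⟨s, hs⟩⟩ := hS.nonempty
      exact absurd (Subsingleton.elim s v ▸ hs) hv
    · exact h.isCHH
    · exact h.isCHH hG h2
    · exact h.isCHH hG
    · exact CHomHom.isCHH_of_iso_bipartiteComplementMatching hG e
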